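/- Let $B_3=\langle \sigma_1,\sigma_2 \mid \sigma_1\sigma_2\sigma_1=\sigma_2\sigma_1\sigma_2\rangle$ be the 3-strand braid group. A 3-strand braid word is a finite word in the letters $\sigma_1^{\pm1},\sigma_2^{\pm1}$. The main generator of a nonempty braid word $w$ is the generator $\sigma_m$ such that $\sigma_m$ or $\sigma_m^{-1}$ occurs in $w$ but no $\sigma_i^{\pm1}$ with $i>m$ does; $w$ is called $\sigma$-positive (resp. $\sigma$-negative) if its main generator occurs only positively (resp. only negatively) in $w$, i.e. $\sigma_m^{-1}$ (resp. $\sigma_m$) does not occur in $w$. Then Property C holds for $B_3$: every element $x\neq 1$ of $B_3$ is represented by a 3-strand braid word that is $\sigma$-positive or $\sigma$-negative. -/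

import Mathlib

/-- The defining relators of the `n`-strand braid group, in the free group on letters `σ₁, …, σ_{n-1}`.
The letter `σ_{k+1}` is indexed by `k : Fin (n - 1)`. -/
inductive BraidRelator (n : ℕ) : FreeGroup (Fin (n - 1)) → Prop
  /-- Far commutation: `σ_i σ_j = σ_j σ_i` for `|i - j| ≥ 2`. -/
  | comm (i j : Fin (n - 1)) (h : 2 ≤ |((i : ℕ) : ℤ) - ((j : ℕ) : ℤ)|) :
      BraidRelator n
        ((FreeGroup.of i * FreeGroup.of j) * (FreeGroup.of j * FreeGroup.of i)⁻¹)
  /-- Braid relation: `σ_i σ_j σ_i = σ_j σ_i σ_j` for `|i - j| = 1`. -/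
  | braid (i j : Fin (n - 1)) (h : |((i : ℕ) : ℤ) - ((j : ℕ) : ℤ)| = 1) :
      BraidRelator n
        ((FreeGroup.of i * FreeGroup.of j * FreeGroup.of i) *
          (FreeGroup.of j * FreeGroup.of i * FreeGroup.of j)⁻¹)

/-- The `n`-strand braid group `B_n`, by its Artin presentation. -/
abbrev BraidGroup (n : ℕ) : Type := PresentedGroup {r | BraidRelator n r}

/-- An `n`-strand braid word: a finite word in the letters `σ_i` (written `(i, true)`) and
`σ_i⁻¹` (written `(i, false)`). -/
abbrev BraidWord (n : ℕ) : Type := List (Fin (n - 1) × Bool)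

namespace BraidWord

/-- The braid `[w]` represented by a braid word `w`. -/
def toBraid {n : ℕ} (w : BraidWord n) : BraidGroup n :=
  (w.map fun a => if a.2 then (PresentedGroup.of a.1 : BraidGroup n)
    else (PresentedGroup.of a.1 : BraidGroup n)⁻¹).prod

/-- `σ_m` is the main generator of `w`: one of `σ_m`, `σ_m⁻¹` occurs in `w`, and no `σ_i`, `σ_i⁻¹`
with `i > m` does. -/
def IsMainGenerator {n : ℕ} (m : Fin (n - 1)) (w : BraidWord n) : Prop :=
  ((m, true) ∈ w ∨ (m, false) ∈ w) ∧ ∀ i, m < i → (i, true) ∉ w ∧ (i, false) ∉ w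

/-- `w` is `σ`-positive: it has a main generator, which occurs only positively.
(The empty word has no main generator.) -/
def SigmaPositive {n : ℕ} (w : BraidWord n) : Prop :=
  ∃ m, IsMainGenerator m w ∧ (m, false) ∉ w

/-- `w` is `σ`-negative: it has a main generator, which occurs only negatively. -/
def SigmaNegative {n : ℕ} (w : BraidWord n) : Prop :=
  ∃ m, IsMainGenerator m w ∧ (m, true) ∉ w

end BraidWord

/-!
Property C for `B₃`. In a group with `a * b * a = b * a * b`, put
`Δ = a * b * a`. Every element of the subgroup generated by `a` and `b` is `Δ ^ m * w`, where `w` is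
a product of letters `a`, `b⁻¹`, or a product of letters `b`, `a⁻¹`. Depending on the sign of `m`,
such an element can be written without `b⁻¹` or without `b`.
-/

namespace BraidRelation

variable {G : Type*} [Group G] {a b : G}

/-! Take `a = σ₁`, `b = σ₂`. Conjugation by `Δ` swaps `a` and `b`, so every `Δ^±1` created by a
clash of letters moves to the left, giving `Δ ^ m * w` (`isDeltaForm_of_mem_closure`). If `m > 0`,
one `Δ` absorbs every `b⁻¹` of `w` (`delta_mul_mem`); `m < 0` is the same for `a⁻¹`, `b⁻¹`; if `m =
0`, `w` already has `b` with one sign only. If no `σ₂` is left, `x` is a nontrivial power of `σ₁`.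
-/

/-- Multiplication by `Δ = a * b * a` exchanges `a` and `b`. -/
theorem delta_mul (h : a * b * a = b * a * b) :
    a * b * a * a = b * (a * b * a) ∧ a * b * a * b = a * (a * b * a) := by
  constructor
  · nth_rw 1 [h]
    simp only [mul_assoc]
  · nth_rw 2 [h]
    simp only [mul_assoc]

theorem mul_mul_inv_mem_of_swap {d w : G} (ha : d * a * d⁻¹ = b) (hb : d * b * d⁻¹ = a)
    (hw : w ∈ Submonoid.closure {a, b⁻¹}) : d * w * d⁻¹ ∈ Submonoid.closure {b, a⁻¹} := by
  have := Submonoid.mem_map_of_mem (MulAut.conj d) hw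
  rw [MonoidHom.map_mclosure, Set.image_pair] at this
  simp only [map_inv, MulAut.conj_apply, ha, hb] at this
  exact this

theorem delta_mul_mul_inv_mem (h : a * b * a = b * a * b) {w : G}
    (hw : w ∈ Submonoid.closure {a, b⁻¹}) :
    (a * b * a) * w * (a * b * a)⁻¹ ∈ Submonoid.closure {b, a⁻¹} :=
  mul_mul_inv_mem_of_swap (mul_inv_eq_of_eq_mul (delta_mul h).1)
    (mul_inv_eq_of_eq_mul (delta_mul h).2) hw

theorem delta_inv_mul_mul_mem (h : a * b * a = b * a * b) {w : G}
    (hw : w ∈ Submonoid.closure {a, b⁻¹}) :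
    (a * b * a)⁻¹ * w * (a * b * a) ∈ Submonoid.closure {b, a⁻¹} := by
  have := mul_mul_inv_mem_of_swap (d := (a * b * a)⁻¹) (a := a) (b := b) (w := w)
  rw [inv_inv, mul_assoc _ a, mul_assoc _ b (a * b * a), inv_mul_eq_iff_eq_mul,
    inv_mul_eq_iff_eq_mul] at this
  exact this (delta_mul h).2.symm (delta_mul h).1.symm hw

/-- Elements `Δ ^ m * w` with `w` a product of letters `a`, `b⁻¹` or of letters `b`, `a⁻¹`. -/
def IsDeltaForm (a b x : G) : Prop :=
  ∃ m : ℤ, ∃ w, (w ∈ Submonoid.closure {a, b⁻¹} ∨ w ∈ Submonoid.closure {b, a⁻¹}) ∧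
    x = (a * b * a) ^ m * w

theorem IsDeltaForm.swap (h : a * b * a = b * a * b) {x : G} (hx : IsDeltaForm a b x) :
    IsDeltaForm b a x := by
  obtain ⟨m, w, hw, rfl⟩ := hx
  exact ⟨m, w, hw.symm, by rw [h]⟩

/-- A letter of the wrong alphabet either cancels the last letter of `w` or merges with it: `b⁻¹ *
a⁻¹ = a * Δ⁻¹` and `a * b = b⁻¹ * Δ`. Moving `Δ^±1` past the rest swaps the alphabets. -/
theorem isDeltaForm_zpow_mul_mul (h : a * b * a = b * a * b) (m : ℤ) {w c : G}
    (hw : w ∈ Submonoid.closure {a, b⁻¹}) (hc : c = a ∨ c = a⁻¹ ∨ c = b ∨ c = b⁻¹) :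
    IsDeltaForm a b ((a * b * a) ^ m * w * c) := by
  have ha : a ∈ Submonoid.closure {a, b⁻¹} := Submonoid.subset_closure (by simp)
  have hb : b⁻¹ ∈ Submonoid.closure {a, b⁻¹} := Submonoid.subset_closure (by simp)
  have of_letter : c ∈ Submonoid.closure {a, b⁻¹} → IsDeltaForm a b ((a * b * a) ^ m * w * c) :=
    fun hc => ⟨m, w * c, .inl (mul_mem hw hc), by group⟩
  rcases hc with rfl | rfl | rfl | rfl
  · exact of_letter ha
  · clear of_letter
    induction hw using Submonoid.closure_induction_right with
    | one => exact ⟨m, a⁻¹, .inr (Submonoid.subset_closure (by simp)), by group⟩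
    | mul_right v hv y hy ih =>
      rcases hy with rfl | rfl
      · exact ⟨m, v, .inl hv, by group⟩
      · refine ⟨m - 1, _, .inr (delta_mul_mul_inv_mem h (mul_mem hv ha)), ?_⟩
        simp [zpow_sub_one, mul_assoc]
  · clear of_letter
    induction hw using Submonoid.closure_induction_right with
    | one => exact ⟨m, c, .inr (Submonoid.subset_closure (by simp)), by group⟩
    | mul_right v hv y hy ih =>
      rcases hy with rfl | rfl
      · refine ⟨m + 1, _, .inr (delta_inv_mul_mul_mem h (mul_mem hv hb)), ?_⟩
        rw [h]
        simp [zpow_add_one, mul_assoc]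
      · exact ⟨m, v, .inl hv, by group⟩
  · exact of_letter hb

theorem IsDeltaForm.mul_letter (h : a * b * a = b * a * b) {x c : G} (hx : IsDeltaForm a b x)
    (hc : c = a ∨ c = a⁻¹ ∨ c = b ∨ c = b⁻¹) : IsDeltaForm a b (x * c) := by
  obtain ⟨m, w, hw | hw, rfl⟩ := hx
  · exact isDeltaForm_zpow_mul_mul h m hw hc
  -- `Δ` is symmetric in `a` and `b`, so this is the first case with the two exchanged.
  · rw [h]
    exact (isDeltaForm_zpow_mul_mul h.symm m hw (by tauto)).swap h.symm

theorem isDeltaForm_of_mem_closure (h : a * b * a = b * a * b) {x : G}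
    (hx : x ∈ Subgroup.closure {a, b}) : IsDeltaForm a b x := by
  induction hx using Subgroup.closure_induction_right with
  | one => exact ⟨0, 1, .inl (one_mem _), by simp⟩
  | mul_right y _ c hc ih =>
    exact ih.mul_letter h (by rcases hc with rfl | rfl <;> simp)
  | mul_inv_cancel y _ c hc ih =>
    exact ih.mul_letter h (by rcases hc with rfl | rfl <;> simp)

/-- Right multiplication by `b⁻¹` turns `b * a ^ (n + 1)` into `a⁻¹ * b ^ (n + 1) * a`, so that
no letter `b⁻¹` survives after `Δ`. -/
theorem delta_mul_mem (h : a * b * a = b * a * b) {w : G}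
    (hw : w ∈ Submonoid.closure {a, b⁻¹}) :
    a * b * a * w ∈ Submonoid.closure {a, a⁻¹, b} := by
  have ha : a ∈ Submonoid.closure {a, a⁻¹, b} := Submonoid.subset_closure (by simp)
  have ha' : a⁻¹ ∈ Submonoid.closure {a, a⁻¹, b} := Submonoid.subset_closure (by simp)
  have hb : b ∈ Submonoid.closure {a, a⁻¹, b} := Submonoid.subset_closure (by simp)
  -- The exponent stays positive: after absorbing `b⁻¹`, the factor `b ^ (n + 1)` still supplies a
  -- `b` for the new tail `b * a`.
  suffices ∃ p ∈ Submonoid.closure {a, a⁻¹, b}, ∃ n : ℕ, a * b * a * w = p * b * a ^ (n + 1) by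
    obtain ⟨p, hp, n, e⟩ := this
    rw [e]
    exact mul_mem (mul_mem hp hb) (pow_mem ha _)
  induction hw using Submonoid.closure_induction_right with
  | one => exact ⟨a, ha, 0, by simp⟩
  | mul_right v hv y hy ih =>
    obtain ⟨p, hp, n, e⟩ := ih
    rcases hy with rfl | rfl
    · exact ⟨p, hp, n + 1, by rw [← mul_assoc, e, pow_succ y (n + 1), ← mul_assoc]⟩
    · refine ⟨p * a⁻¹ * b ^ n, mul_mem (mul_mem hp ha') (pow_mem hb _), 0, ?_⟩
      have hs : SemiconjBy (a * b) a b := by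
        rw [SemiconjBy, h, mul_assoc]
      have hn : b * a ^ (n + 1) = a⁻¹ * b ^ (n + 1) * (a * b) := by
        rw [mul_assoc a⁻¹, ← (hs.pow_right (n + 1)).eq, mul_assoc, inv_mul_cancel_left]
      rw [← mul_assoc, e, mul_assoc p b, hn, pow_succ b]
      simp [mul_assoc]

theorem delta_pow_succ_mul_mem (h : a * b * a = b * a * b) {w : G}
    (hw : w ∈ Submonoid.closure {a, b⁻¹} ∨ w ∈ Submonoid.closure {b, a⁻¹}) (n : ℕ) :
    (a * b * a) ^ (n + 1) * w ∈ Submonoid.closure {a, a⁻¹, b} := by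
  have ha : a ∈ Submonoid.closure {a, a⁻¹, b} := Submonoid.subset_closure (by simp)
  have hb : b ∈ Submonoid.closure {a, a⁻¹, b} := Submonoid.subset_closure (by simp)
  have hd : a * b * a ∈ Submonoid.closure {a, a⁻¹, b} := mul_mem (mul_mem ha hb) ha
  rcases hw with hw | hw
  · rw [pow_succ, mul_assoc]
    exact mul_mem (pow_mem hd _) (delta_mul_mem h hw)
  · refine mul_mem (pow_mem hd _) (Submonoid.closure_mono ?_ hw)
    rintro _ (rfl | rfl) <;> simp

theorem mem_closure_or_mem_closure (h : a * b * a = b * a * b) {x : G}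
    (hx : x ∈ Subgroup.closure {a, b}) :
    x ∈ Submonoid.closure {a, a⁻¹, b} ∨ x ∈ Submonoid.closure {a, a⁻¹, b⁻¹} := by
  obtain ⟨m, w, hw, rfl⟩ := isDeltaForm_of_mem_closure h hx
  obtain ⟨n, rfl⟩ | rfl | ⟨n, rfl⟩ : (∃ n : ℕ, m = (n + 1 : ℕ)) ∨ m = 0 ∨
      ∃ n : ℕ, m = -((n + 1 : ℕ) : ℤ) := by
    rcases lt_trichotomy m 0 with hm | hm | hm
    · exact .inr (.inr ⟨(-m - 1).toNat, by omega⟩)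
    · exact .inr (.inl hm)
    · exact .inl ⟨(m - 1).toNat, by omega⟩
  · rw [zpow_natCast]
    exact .inl (delta_pow_succ_mul_mem h hw n)
  · rw [zpow_zero, one_mul]
    rcases hw with hw | hw
    · refine .inr (Submonoid.closure_mono ?_ hw)
      rintro _ (rfl | rfl) <;> simp
    · refine .inl (Submonoid.closure_mono ?_ hw)
      rintro _ (rfl | rfl) <;> simp
  -- The inverses satisfy the same relation, with `Δ⁻¹` in the role of `Δ` and the two alphabets
  -- exchanged.
  · have h' : a⁻¹ * b⁻¹ * a⁻¹ = b⁻¹ * a⁻¹ * b⁻¹ := by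
      simpa [mul_assoc] using congrArg (·⁻¹) h
    have := delta_pow_succ_mul_mem h' (w := w) (by
      simp only [inv_inv]
      rw [Set.pair_comm a⁻¹, Set.pair_comm b⁻¹]
      exact hw.symm) n
    rw [inv_inv, Set.insert_comm] at this
    refine .inr ?_
    convert this using 2
    rw [zpow_neg, zpow_natCast, ← inv_pow]
    simp [mul_assoc]

end BraidRelation

namespace BraidWord

theorem toBraid_append {n : ℕ} (v w : BraidWord n) :
    toBraid (v ++ w) = toBraid v * toBraid w := by
  simp [toBraid]

theorem toBraid_replicate {n : ℕ} (k : ℕ) (a : Fin (n - 1) × Bool) :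
    toBraid (List.replicate k a) = toBraid [a] ^ k := by
  simp [toBraid]

/-- A product of letters `σ₁`, `σ₁⁻¹` and one of `σ₂`, `σ₂⁻¹` is a power of `σ₁`, or has a word
in which only the given sign of `σ₂` occurs. -/
theorem mem_zpowers_or_exists_word (s : Bool) {x : BraidGroup 3}
    (hx : x ∈ Submonoid.closure {toBraid (n := 3) [(0, true)], (toBraid (n := 3) [(0, true)])⁻¹,
      toBraid (n := 3) [(1, s)]}) :
    x ∈ Subgroup.zpowers (toBraid (n := 3) [(0, true)]) ∨
      ∃ w : BraidWord 3, w.toBraid = x ∧ (1, s) ∈ w ∧ (1, !s) ∉ w := by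
  -- Unlike the disjunction, this form always keeps a word to which the induction can append.
  suffices ∃ w : BraidWord 3, w.toBraid = x ∧ (1, !s) ∉ w ∧
      ((1, s) ∉ w → x ∈ Subgroup.zpowers (toBraid (n := 3) [(0, true)])) by
    obtain ⟨w, e, hw, hz⟩ := this
    by_cases hs : (1, s) ∈ w
    · exact .inr ⟨w, e, hs, hw⟩
    · exact .inl (hz hs)
  induction hx using Submonoid.closure_induction_right with
  | one => exact ⟨[], by simp [toBraid], by simp, fun _ => one_mem _⟩
  | mul_right v _ y hy ih =>
    obtain ⟨w, rfl, hw, hz⟩ := ih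
    rcases hy with rfl | rfl | rfl
    · exact ⟨w ++ [(0, true)], toBraid_append _ _, by simp [hw],
        fun h => mul_mem (hz (by simpa using h)) (Subgroup.mem_zpowers _)⟩
    · exact ⟨w ++ [(0, false)], by rw [toBraid_append]; simp [toBraid], by simp [hw],
        fun h => mul_mem (hz (by simpa using h)) (inv_mem (Subgroup.mem_zpowers _))⟩
    · exact ⟨w ++ [(1, s)], toBraid_append _ _, by simp [hw], fun h => absurd (by simp) h⟩

theorem isMainGenerator_last {w : BraidWord 3} (h : (1, true) ∈ w ∨ (1, false) ∈ w) :
    IsMainGenerator (1 : Fin (3 - 1)) w :=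
  ⟨h, fun i hi => absurd hi (by have := i.2; rw [Fin.lt_def, Fin.val_one]; omega)⟩

theorem isMainGenerator_replicate {n k : ℕ} (hk : k ≠ 0) (m : Fin (n - 1)) (s : Bool) :
    IsMainGenerator m (List.replicate k (m, s) : BraidWord n) := by
  refine ⟨by cases s <;> simp [hk], fun i hi => ?_⟩
  simp [List.mem_replicate, hi.ne']

end BraidWord

open BraidWord in
theorem braidGroup_three_mem_closure (x : BraidGroup 3) :
    x ∈ Subgroup.closure {toBraid (n := 3) [(0, true)], toBraid (n := 3) [(1, true)]} := by
  have hx : x ∈ Subgroup.closure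
      (Set.range (PresentedGroup.of (rels := {r | BraidRelator 3 r}))) := by
    rw [PresentedGroup.closure_range_of]
    trivial
  refine Subgroup.closure_mono ?_ hx
  rintro _ ⟨i, rfl⟩
  fin_cases i <;> simp [toBraid]

open BraidWord in
theorem braidGroup_three_relation :
    toBraid (n := 3) [(0, true)] * toBraid (n := 3) [(1, true)] * toBraid (n := 3) [(0, true)] =
      toBraid (n := 3) [(1, true)] * toBraid (n := 3) [(0, true)] *
        toBraid (n := 3) [(1, true)] := by
  have := PresentedGroup.one_of_mem (rels := {r | BraidRelator 3 r})
    (BraidRelator.braid (n := 3) 0 1 (by simp))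
  rw [map_mul, map_inv, mul_inv_eq_one] at this
  simp only [toBraid, List.map_cons, List.map_nil, List.prod_singleton, if_true]
  exact this

open BraidWord in
theorem proposition4p17 (x : BraidGroup 3) (hx : x ≠ 1) :
    ∃ w : BraidWord 3, w.toBraid = x ∧ (w.SigmaPositive ∨ w.SigmaNegative) := by
  have key : x ∈ Subgroup.zpowers (toBraid (n := 3) [(0, true)]) ∨
      ∃ s, ∃ w : BraidWord 3, w.toBraid = x ∧ (1, s) ∈ w ∧ (1, !s) ∉ w := by
    rcases BraidRelation.mem_closure_or_mem_closure braidGroup_three_relation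
      (braidGroup_three_mem_closure x) with h | h
    · exact (mem_zpowers_or_exists_word true h).imp_right fun h => ⟨true, h⟩
    · refine (mem_zpowers_or_exists_word false ?_).imp_right fun h => ⟨false, h⟩
      convert h using 5
      simp [toBraid]
  rcases key with ⟨k, rfl⟩ | ⟨s, w, e, h, h'⟩
  · obtain ⟨n, rfl | rfl⟩ := k.eq_nat_or_neg
    -- The empty word has no main generator; `x ≠ 1` rules it out.
    · have hn : n ≠ 0 := by rintro rfl; simp at hx
      refine ⟨List.replicate n (0, true), ?_, .inl ⟨0, isMainGenerator_replicate hn _ _, ?_⟩⟩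
      · exact (toBraid_replicate _ _).trans (zpow_natCast _ _).symm
      · simp [List.mem_replicate]
    · have hn : n ≠ 0 := by rintro rfl; simp at hx
      refine ⟨List.replicate n (0, false), ?_, .inr ⟨0, isMainGenerator_replicate hn _ _, ?_⟩⟩
      · rw [toBraid_replicate]
        simp [toBraid]
      · simp [List.mem_replicate]
  · cases s
    · exact ⟨w, e, .inr ⟨1, isMainGenerator_last (.inr h), h'⟩⟩
    · exact ⟨w, e, .inl ⟨1, isMainGenerator_last (.inl h), h'⟩⟩
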